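/- **Theorem (small-time lack of boundary controllability).** Let $a,\mu,\kappa,\rho_s,u_s>0$ and $\gamma\ge 1$ be real constants and put $b=a\gamma\rho_s^{\gamma-2}$. For $T>0$ consider on $(0,T)\times(0,2\pi)$ the linearized compressible Navier–Stokes system with Maxwell's law $$\begin{cases}\partial_t\rho+u_s\partial_x\rho+\rho_s\partial_xu=0,\\ \partial_tu+u_s\partial_xu+b\,\partial_x\rho-\frac1{\rho_s}\partial_xS=0,\\ \partial_tS+\frac1\kappa S-\frac\mu\kappa\partial_xu=0,\end{cases}\qquad (\rho,u,S)(0,\cdot)=(\rho_0,u_0,S_0),$$ with one of the following boundary conditions for $t\in(0,T)$, where $q,r,p\in L^2(0,T)$ (complex valued) are the controls: * (velocity control) $\rho(t,0)=\rho(t,2\pi)$, $u(t,0)=u(t,2\pi)+r(t)$, $S(t,0)=S(t,2\pi)$; * (density control) $\rho(t,0)=\rho(t,2\pi)+q(t)$, $u(t,0)=u(t,2\pi)$, $S(t,0)=S(t,2\pi)$; * (stress control) $\rho(t,0)=\rho(t,2\pi)$, $u(t,0)=u(t,2\pi)$, $S(t,0)=S(t,2\pi)+p(t)$. Solutions $(\rho,u,S)\in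 C([0,T];L^2(0,2\pi;\mathbb C)^3)$ are understood in the sense of transposition: for every $\tau\in[0,T]$ the identities obtained by multiplying the equations by smooth functions of $(t,x)$ that are $2\pi$-periodic in $x$, and integrating by parts over $(0,\tau)\times(0,2\pi)$, hold. For a space of states $V\subseteq L^2(0,2\pi)^3$, the system with one of these controls is called exactly controllable in $V$ at time $T$ if for all $(\rho_0,u_0,S_0)$ and $(\rho_1,u_1,S_1)$ in $V$ there is a control in $L^2(0,T)$ such that the corresponding solution satisfies $(\rho,u,S)(T,\cdot)=(\rho_1,u_1,S_1)$. Let $\dot L^2(0,2\pi)$ denote the functions in $L^2(0,2\pi)$ with mean value zero. Let $\beta_1,\beta_2,\beta_3$ be the roots (which are real, nonzero and distinct) of $$r^3+2u_sr^2+\Big(u_s^2-b\rho_s-\frac{\mu}{\kappa\rho_s}\Big)r-\frac{\mu u_s}{\kappa\rho_s}=0,$$ and let $\beta=\min\{|\beta_1|,|\beta_2|,|\beta_3|\}$. If $0<T<\frac{2\pi}{\beta}$, then the system with velocity control is not exactly controllable at time $T$, neither in $L^2(0,2\pi)^3$ nor in $\dot L^2(0,2\pi)^3$. The same holds for the system with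 density control and for the system with stress control. -/

import Mathlib

open MeasureTheory Set
open scoped Real ContDiff

namespace MaxwellNS

/-- Physical constants of the one-dimensional compressible Navier-Stokes system with Maxwell law:
pressure law `p(ρ) = a ρ ^ γ`, relaxation time `κ`, viscosity `μ`, and the constant steady state
`(ρs, us, 0)` around which the system is linearized. -/
structure Params where
  a : ℝ
  γ : ℝ
  μ : ℝ
  κ : ℝ
  ρs : ℝ
  us : ℝ
  a_pos : 0 < a
  one_le_γ : 1 ≤ γ
  μ_pos : 0 < μ
  κ_pos : 0 < κ
  ρs_pos : 0 < ρs
  us_pos : 0 < us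

/-- The constant `b = a γ ρs ^ (γ - 2)`. -/
noncomputable def Params.b (P : Params) : ℝ := P.a * P.γ * P.ρs ^ (P.γ - 2)

/-- The cubic whose roots `β₁, β₂, β₃` are the speeds of the characteristics `x + βⱼ t = const`. -/
noncomputable def Params.speedCubic (P : Params) (r : ℝ) : ℝ :=
  r ^ 3 + 2 * P.us * r ^ 2 + (P.us ^ 2 - P.b * P.ρs - P.μ / (P.κ * P.ρs)) * r
    - P.μ * P.us / (P.κ * P.ρs)

/-- `β = min {|β₁|, |β₂|, |β₃|}`, the least modulus of a root of the cubic. All three roots are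
real (see `Params.exists_roots`), and the infimum is this minimum (see `Params.β_eq_min`). -/
noncomputable def Params.β (P : Params) : ℝ :=
  sInf ((fun r : ℝ => |r|) '' {r : ℝ | P.speedCubic r = 0})

theorem Params.b_pos (P : Params) : 0 < P.b :=
  mul_pos (mul_pos P.a_pos (lt_of_lt_of_le one_pos P.one_le_γ)) (Real.rpow_pos_of_pos P.ρs_pos _)

/-- The cubic has three distinct nonzero real roots. -/
theorem Params.exists_roots (P : Params) :
    ∃ β₁ β₂ β₃ : ℝ, β₁ < β₂ ∧ β₂ < 0 ∧ 0 < β₃ ∧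
      ∀ r : ℝ, P.speedCubic r = (r - β₁) * (r - β₂) * (r - β₃) := by
  have hb : 0 < P.b * P.ρs := mul_pos P.b_pos P.ρs_pos
  have hm : 0 < P.μ / (P.κ * P.ρs) := div_pos P.μ_pos (mul_pos P.κ_pos P.ρs_pos)
  have hu := P.us_pos
  have key : ∀ r : ℝ, P.speedCubic r = r ^ 3 + 2 * P.us * r ^ 2
      + (P.us ^ 2 - P.b * P.ρs - P.μ / (P.κ * P.ρs)) * r
      - P.μ / (P.κ * P.ρs) * P.us := by
    intro r
    unfold Params.speedCubic
    ring
  generalize P.μ / (P.κ * P.ρs) = m at hm key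
  generalize P.b * P.ρs = c at hb key
  generalize P.us = u at hu key
  have hc : Continuous P.speedCubic := by
    rw [show P.speedCubic = _ from funext key]
    fun_prop
  have h0 : P.speedCubic 0 < 0 := by
    rw [key]
    nlinarith [mul_pos hm hu]
  have hneg : 0 < P.speedCubic (-u) := by
    rw [key]
    nlinarith [mul_pos hb hu]
  have hplus : 0 < P.speedCubic (1 + u + c + m) := by
    rw [key]
    have : (0 : ℝ) < 1 + u + c + m := by positivity
    have h1 : (1 + u + c + m) ^ 3 + 2 * u * (1 + u + c + m) ^ 2
      + (u ^ 2 - c - m) * (1 + u + c + m) - m * u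
      = (1 + u + c + m) * ((1 + u + c + m) ^ 2 - (1 + u + c + m))
        + (1 + u + c + m) * (1 + u) + (2 * u * (1 + u + c + m) ^ 2 - m * u)
        + u ^ 2 * (1 + u + c + m) := by ring
    have h2 : 0 ≤ (1 + u + c + m) ^ 2 - (1 + u + c + m) := by nlinarith
    have h3 : 0 ≤ 2 * u * (1 + u + c + m) ^ 2 - m * u := by
      have : m ≤ 2 * (1 + u + c + m) ^ 2 := by nlinarith
      nlinarith
    rw [h1]
    positivity
  have hminus : P.speedCubic (-(1 + 2 * u + c + m)) < 0 := by
    rw [key]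
    have e : (-(1 + 2 * u + c + m)) ^ 3 + 2 * u * (-(1 + 2 * u + c + m)) ^ 2
      + (u ^ 2 - c - m) * (-(1 + 2 * u + c + m)) - m * u
      = -((1 + 2 * u + c + m) * ((1 + u + c + m) ^ 2 - (c + m)) + m * u) := by ring
    rw [e]
    have h2 : 0 < (1 + u + c + m) ^ 2 - (c + m) := by nlinarith
    have : 0 < (1 + 2 * u + c + m) * ((1 + u + c + m) ^ 2 - (c + m)) + m * u := by positivity
    linarith
  obtain ⟨x, ⟨_, hx2⟩, hx⟩ := intermediate_value_Ioo (by linarith : -(1 + 2 * u + c + m) ≤ -u)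
    hc.continuousOn ⟨hminus, hneg⟩
  obtain ⟨y, ⟨hy1, hy2⟩, hy⟩ := intermediate_value_Ioo' (by linarith : -u ≤ 0)
    hc.continuousOn ⟨h0, hneg⟩
  obtain ⟨z, ⟨hz1, _⟩, hz⟩ := intermediate_value_Ioo
    (by positivity : (0 : ℝ) ≤ 1 + u + c + m) hc.continuousOn ⟨h0, hplus⟩
  refine ⟨x, y, z, by linarith, hy2, hz1, fun r => ?_⟩
  rw [key] at hx hy hz ⊢
  have hxy : x - y ≠ 0 := by intro h; linarith
  have hyz : y - z ≠ 0 := by intro h; linarith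
  have hxz : x - z ≠ 0 := by intro h; linarith
  have a1 : x ^ 2 + x * y + y ^ 2 + 2 * u * (x + y) + (u ^ 2 - c - m) = 0 := by
    apply mul_left_cancel₀ hxy
    linear_combination hx - hy
  have a2 : x ^ 2 + x * z + z ^ 2 + 2 * u * (x + z) + (u ^ 2 - c - m) = 0 := by
    apply mul_left_cancel₀ hxz
    linear_combination hx - hz
  have a3 : x + y + z + 2 * u = 0 := by
    apply mul_left_cancel₀ hyz
    linear_combination a1 - a2
  linear_combination (r - x) * a1 + hx + (r - x) * (r - y) * a3

/-- `β` is the minimum of the moduli of the three roots. -/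
theorem Params.β_eq_min (P : Params) {β₁ β₂ β₃ : ℝ}
    (h : ∀ r : ℝ, P.speedCubic r = (r - β₁) * (r - β₂) * (r - β₃)) :
    P.β = min |β₁| (min |β₂| |β₃|) := by
  have hs : {r : ℝ | P.speedCubic r = 0} = {β₁, β₂, β₃} := by
    ext r
    simp [h, sub_eq_zero, or_assoc]
  rw [Params.β, hs, image_insert_eq, image_insert_eq, image_singleton,
    csInf_insert (by simp) (by simp), csInf_insert (by simp) (by simp), csInf_singleton]

/-- The interval `(0, 2π)` with Lebesgue measure. -/
noncomputable def intervalMeasure : Measure ℝ := volume.restrict (Ioo 0 (2 * π))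

/-- `L²(0, 2π)`, complex valued. -/
abbrev L2 : Type := Lp ℂ 2 intervalMeasure

/-- `L²(0, 2π) × L²(0, 2π) × L²(0, 2π)`, with elements `(ρ, u, S)`. -/
abbrev State : Type := L2 × L2 × L2

/-- The states whose three components have mean value zero. -/
def meanZero : Set State :=
  {z | (∫ x, z.1 x ∂intervalMeasure) = 0 ∧ (∫ x, z.2.1 x ∂intervalMeasure) = 0 ∧
    (∫ x, z.2.2 x ∂intervalMeasure) = 0}

/-- Smooth test functions of `(t, x)` that are `2π`-periodic in `x`. -/
def IsTest (φ : ℝ → ℝ → ℂ) : Prop :=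
  ContDiff ℝ ∞ (fun y : ℝ × ℝ => φ y.1 y.2) ∧ ∀ t, Function.Periodic (φ t) (2 * π)

/-- Time derivative of a test function. -/
noncomputable def dt (φ : ℝ → ℝ → ℂ) (t x : ℝ) : ℂ := deriv (fun s => φ s x) t

/-- Space derivative of a test function. -/
noncomputable def dx (φ : ℝ → ℝ → ℂ) (t x : ℝ) : ℂ := deriv (fun y => φ t y) x

/-- `z = (ρ, u, S) ∈ C([0,T]; L²(0,2π)³)` is the solution, in the sense of transposition, of

  `ρ_t + us ρ_x + ρs u_x = 0`,
  `u_t + us u_x + b ρ_x - (1/ρs) S_x = 0`,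
  `S_t + (1/κ) S - (μ/κ) u_x = 0`   in `(0,T) × (0,2π)`,

with `ρ(t,0) = ρ(t,2π) + q(t)`, `u(t,0) = u(t,2π) + r(t)`, `S(t,0) = S(t,2π) + p(t)` and initial
state `z0`: the identities obtained by multiplying the three equations by test functions and
integrating by parts over `(0,τ) × (0,2π)` hold for every `τ ∈ [0,T]`. -/
structure IsSolution (P : Params) (T : ℝ) (q r p : ℝ → ℂ) (z0 : State) (z : ℝ → State) :
    Prop where
  continuousOn : ContinuousOn z (Icc 0 T)
  initial : z 0 = z0
  density : ∀ φ, IsTest φ → ∀ τ ∈ Icc 0 T,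
    (∫ x, (z τ).1 x * φ τ x ∂intervalMeasure) - (∫ x, z0.1 x * φ 0 x ∂intervalMeasure)
      = (∫ t in (0 : ℝ)..τ, ∫ x, ((z t).1 x * dt φ t x
          + (P.us * (z t).1 x + P.ρs * (z t).2.1 x) * dx φ t x) ∂intervalMeasure)
        + ∫ t in (0 : ℝ)..τ, (P.us * q t + P.ρs * r t) * φ t (2 * π)
  velocity : ∀ φ, IsTest φ → ∀ τ ∈ Icc 0 T,
    (∫ x, (z τ).2.1 x * φ τ x ∂intervalMeasure) - (∫ x, z0.2.1 x * φ 0 x ∂intervalMeasure)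
      = (∫ t in (0 : ℝ)..τ, ∫ x, ((z t).2.1 x * dt φ t x
          + (P.us * (z t).2.1 x + P.b * (z t).1 x - (1 / P.ρs) * (z t).2.2 x) * dx φ t x)
            ∂intervalMeasure)
        + ∫ t in (0 : ℝ)..τ, (P.us * r t + P.b * q t - (1 / P.ρs) * p t) * φ t (2 * π)
  stress : ∀ φ, IsTest φ → ∀ τ ∈ Icc 0 T,
    (∫ x, (z τ).2.2 x * φ τ x ∂intervalMeasure) - (∫ x, z0.2.2 x * φ 0 x ∂intervalMeasure)
      = (∫ t in (0 : ℝ)..τ, ∫ x, ((z t).2.2 x * dt φ t x - (1 / P.κ) * (z t).2.2 x * φ t x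
          - (P.μ / P.κ) * (z t).2.1 x * dx φ t x) ∂intervalMeasure)
        - ∫ t in (0 : ℝ)..τ, (P.μ / P.κ) * r t * φ t (2 * π)

/-- The periodicity condition in which the single control acts. -/
inductive Component where
  | density
  | velocity
  | stress

/-- `z` is the solution when the single control `c` acts in the periodicity condition of the
given component, the other two conditions being homogeneous. -/
def IsControlledSolution (P : Params) (T : ℝ) : Component → (ℝ → ℂ) → State → (ℝ → State) → Prop
  | .density, c => IsSolution P T c 0 0
  | .velocity, c => IsSolution P T 0 c 0
  | .stress, c => IsSolution P T 0 0 c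

/-- Exact controllability at time `T` in the space of states `V`, by a boundary control in
`L²(0,T)` acting in component `j`: every initial state in `V` can be steered to every target state
in `V`. -/
def IsExactlyControllable (P : Params) (j : Component) (V : Set State) (T : ℝ) : Prop :=
  ∀ z0 ∈ V, ∀ z1 ∈ V, ∃ c : ℝ → ℂ, MemLp c 2 (volume.restrict (Ioo 0 T)) ∧
    ∃ z : ℝ → State, IsControlledSolution P T j c z0 z ∧ z T = z1

end MaxwellNS

namespace MaxwellNS

/-! The boundary controls cannot influence a characteristic that stays inside the domain during the
whole of `[0, T]`, and since `β * T < 2π` the slowest family of characteristics contains such lines.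
Along them a state reached from rest is more regular than a general `L²` function, so not every
target is attained.

To make this quantitative, the solution is tested against packets `exp (δ t) (e G' + g G)(x - l t)`,
where `l` is minus a root of the cubic. The amplitudes (`exists_isAmplitude`) make these solve the
adjoint system up to a remainder involving `G` but none of its derivatives. If `G` and `G'` vanish
on the part of the packet that meets the boundary, every control term disappears
(`IsSolution.packet_identity`).

With `G = χ(y) exp (i n y)`, the remainder is bounded uniformly in `n` while the packet itself has
size `n`. If all targets `(0, u, 0)` with `u` of mean zero were reachable from rest, the pairings of
each `u` with the packets would be bounded in `n`, with a bound depending on `u`. Banach–Steinhaus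
makes the bound uniform over the unit ball, whereas pairing with `χ exp (-i n y)` grows like `n`
(`not_forall_reachable`). The argument needs neither well-posedness nor an estimate of the controls,
and treats the three kinds of control at once. -/

instance : IsFiniteMeasure intervalMeasure := by
  unfold intervalMeasure; infer_instance

/-! ### Pairing of `L²` with continuous functions -/

theorem integrable_mul_of_continuous (f : L2) {g : ℝ → ℂ} (hg : Continuous g) :
    Integrable (fun x => f x * g x) intervalMeasure := by
  have hf : Integrable f intervalMeasure := (Lp.memLp f).integrable (by norm_num)
  obtain ⟨C, hC⟩ := (isCompact_Icc (a := (0 : ℝ)) (b := 2 * π)).exists_bound_of_continuousOn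
    hg.continuousOn
  refine hf.mul_bdd (c := C) hg.aestronglyMeasurable ?_
  filter_upwards [ae_restrict_mem measurableSet_Ioo] with x hx
  exact hC x (Ioo_subset_Icc_self hx)

theorem norm_integral_mul_le (f : L2) {g : ℝ → ℂ} {C : ℝ} (hC0 : 0 ≤ C)
    (hC : ∀ x ∈ Ioo 0 (2 * π), ‖g x‖ ≤ C) :
    ‖∫ x, f x * g x ∂intervalMeasure‖ ≤ (C * (1 + 2 * π)) * ‖f‖ := by
  have hf : Integrable f intervalMeasure := (Lp.memLp f).integrable (by norm_num)
  have h1 : ‖∫ x, f x * g x ∂intervalMeasure‖ ≤ ∫ x, C * ‖f x‖ ∂intervalMeasure := by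
    refine norm_integral_le_of_norm_le (hf.norm.const_mul C) ?_
    filter_upwards [ae_restrict_mem measurableSet_Ioo] with x hx
    rw [norm_mul, mul_comm]
    exact mul_le_mul_of_nonneg_right (hC x hx) (norm_nonneg _)
  have h2 : ∫ x, ‖f x‖ ∂intervalMeasure ≤ (1 + 2 * π) * ‖f‖ := by
    have hle := eLpNorm_le_eLpNorm_mul_rpow_measure_univ (p := 1) (q := 2)
      (μ := intervalMeasure) (by norm_num) (Lp.aestronglyMeasurable f)
    have hμ : intervalMeasure univ = ENNReal.ofReal (2 * π) := by
      simp [intervalMeasure]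
    rw [hμ, ENNReal.ofReal_rpow_of_pos (by positivity)] at hle
    have h3 := ENNReal.toReal_mono
      (ENNReal.mul_ne_top (Lp.eLpNorm_ne_top f) ENNReal.ofReal_ne_top) hle
    rw [ENNReal.toReal_mul, ENNReal.toReal_ofReal (by positivity), ← Lp.norm_def,
      eLpNorm_one_eq_lintegral_enorm, ← integral_norm_eq_lintegral_enorm
        (Lp.aestronglyMeasurable f)] at h3
    refine h3.trans ?_
    rw [mul_comm]
    refine mul_le_mul_of_nonneg_right ?_ (norm_nonneg _)
    -- Hölder gives the factor `√(2π)`; it is replaced by the cruder `1 + 2π`.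
    have hp := Real.pi_gt_three
    calc (2 * π) ^ (1 / (1 : ENNReal).toReal - 1 / (2 : ENNReal).toReal)
        ≤ (2 * π) ^ (1 : ℝ) := by
          refine Real.rpow_le_rpow_of_exponent_le (by linarith) ?_
          norm_num
      _ ≤ 1 + 2 * π := by rw [Real.rpow_one]; linarith
  rw [integral_const_mul] at h1
  calc _ ≤ _ := h1
    _ ≤ C * ((1 + 2 * π) * ‖f‖) := mul_le_mul_of_nonneg_left h2 hC0
    _ = _ := by ring

/-- The functional `f ↦ ∫ f g` on `L²(0, 2π)`. -/
noncomputable def pairing (g : ℝ → ℂ) (hg : Continuous g) : L2 →L[ℂ] ℂ :=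
  LinearMap.mkContinuousOfExistsBound
    { toFun := fun f => ∫ x, f x * g x ∂intervalMeasure
      map_add' := fun f f' => by
        rw [← integral_add (integrable_mul_of_continuous f hg)
          (integrable_mul_of_continuous f' hg)]
        refine integral_congr_ae ?_
        filter_upwards [Lp.coeFn_add f f'] with x hx
        rw [hx, Pi.add_apply, add_mul]
      map_smul' := fun c f => by
        rw [RingHom.id_apply, smul_eq_mul, ← integral_const_mul]
        refine integral_congr_ae ?_
        filter_upwards [Lp.coeFn_smul c f] with x hx
        rw [hx, Pi.smul_apply, smul_eq_mul, mul_assoc] }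
    (by
      obtain ⟨C, hC⟩ := (isCompact_Icc (a := (0 : ℝ)) (b := 2 * π)).exists_bound_of_continuousOn
        hg.continuousOn
      have hC0 : 0 ≤ C := (norm_nonneg _).trans (hC 0 ⟨le_rfl, by positivity⟩)
      exact ⟨_, fun f => norm_integral_mul_le f hC0 fun x hx => hC x (Ioo_subset_Icc_self hx)⟩)

theorem pairing_apply (g : ℝ → ℂ) (hg : Continuous g) (f : L2) :
    pairing g hg f = ∫ x, f x * g x ∂intervalMeasure := rfl

/-- Near a time `s`, split `f t = (f t - f s) + f s`: the first part is small in norm against a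
bounded `ψ`, the second is handled by dominated convergence. This supplies the integrability in time
needed to combine the three weak identities. -/
theorem continuousOn_integral_mul {T : ℝ} {f : ℝ → L2} (hf : ContinuousOn f (Icc 0 T))
    {ψ : ℝ → ℝ → ℂ} (hψ : Continuous fun y : ℝ × ℝ => ψ y.1 y.2) :
    ContinuousOn (fun t => ∫ x, f t x * ψ t x ∂intervalMeasure) (Icc 0 T) := by
  obtain ⟨C, hC⟩ := ((isCompact_Icc (a := (0 : ℝ)) (b := T)).prod
    (isCompact_Icc (a := (0 : ℝ)) (b := 2 * π))).exists_bound_of_continuousOn hψ.continuousOn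
  have hψt : ∀ t, Continuous (ψ t) := fun t => hψ.comp (by fun_prop : Continuous fun x => (t, x))
  intro s hs
  have hC0 : 0 ≤ C := (norm_nonneg _).trans (hC (s, 0) ⟨hs, le_rfl, by positivity⟩)
  have hbound : ∀ t ∈ Icc 0 T, ∀ x ∈ Ioo 0 (2 * π), ‖ψ t x‖ ≤ C := fun t ht x hx =>
    hC (t, x) ⟨ht, Ioo_subset_Icc_self hx⟩
  have hfs : Integrable (f s) intervalMeasure := (Lp.memLp (f s)).integrable (by norm_num)
  have h1 : ContinuousWithinAt (fun t => ∫ x, f s x * ψ t x ∂intervalMeasure) (Icc 0 T) s := by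
    refine continuousWithinAt_of_dominated (bound := fun x => C * ‖f s x‖) ?_ ?_
      (hfs.norm.const_mul C) ?_
    · exact Filter.Eventually.of_forall fun t =>
        (integrable_mul_of_continuous (f s) (hψt t)).aestronglyMeasurable
    · filter_upwards [self_mem_nhdsWithin] with t ht
      filter_upwards [ae_restrict_mem measurableSet_Ioo] with x hx
      rw [norm_mul, mul_comm]
      exact mul_le_mul_of_nonneg_right (hbound t ht x hx) (norm_nonneg _)
    · refine Filter.Eventually.of_forall fun x => ?_
      have : Continuous fun t => f s x * ψ t x :=
        continuous_const.mul (hψ.comp (by fun_prop : Continuous fun t => (t, x)))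
      exact this.continuousWithinAt
  have h2 : Filter.Tendsto (fun t => ∫ x, (f t - f s : L2) x * ψ t x ∂intervalMeasure)
      (nhdsWithin s (Icc 0 T)) (nhds 0) := by
    refine squeeze_zero_norm' (a := fun t => (C * (1 + 2 * π)) * ‖f t - f s‖) ?_ ?_
    · filter_upwards [self_mem_nhdsWithin] with t ht
      exact norm_integral_mul_le _ hC0 (hbound t ht)
    · have h3 : ContinuousWithinAt (fun t => (C * (1 + 2 * π)) * ‖f t - f s‖) (Icc 0 T) s :=
        continuousWithinAt_const.mul ((hf s hs).sub continuousWithinAt_const).norm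
      simpa [ContinuousWithinAt] using h3
  have h4 := h2.add h1
  rw [zero_add] at h4
  refine Filter.Tendsto.congr (fun t => ?_) h4
  rw [← pairing_apply _ (hψt t), ← pairing_apply _ (hψt t), ← pairing_apply _ (hψt t), map_sub,
    sub_add_cancel]

/-! ### Wave packets -/

/-- The function `exp (δ t) (e G'(x - λ t) + g G(x - λ t))`. -/
noncomputable def packet (δ l e g : ℝ) (G : ℝ → ℂ) (t x : ℝ) : ℂ :=
  (Real.exp (δ * t) : ℂ) * (e * deriv G (x - l * t) + g * G (x - l * t))

theorem contDiff_packet (δ l e g : ℝ) {G : ℝ → ℂ} (hG : ContDiff ℝ ∞ G) :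
    ContDiff ℝ ∞ (fun y : ℝ × ℝ => packet δ l e g G y.1 y.2) := by
  have hG' : ContDiff ℝ ∞ (deriv G) := (contDiff_infty_iff_deriv.1 hG).2
  have h1 : ContDiff ℝ ∞ (fun y : ℝ × ℝ => y.2 - l * y.1) := by fun_prop
  have h2 : ContDiff ℝ ∞ (fun y : ℝ × ℝ => (Real.exp (δ * y.1) : ℂ)) :=
    Complex.ofRealCLM.contDiff.comp (by fun_prop : ContDiff ℝ ∞ fun y : ℝ × ℝ =>
      Real.exp (δ * y.1))
  exact h2.mul ((contDiff_const.mul (hG'.comp h1)).add (contDiff_const.mul (hG.comp h1)))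

theorem isTest_packet (δ l e g : ℝ) {G : ℝ → ℂ} (hG : ContDiff ℝ ∞ G)
    (hper : Function.Periodic G (2 * π)) : IsTest (packet δ l e g G) := by
  refine ⟨contDiff_packet δ l e g hG, fun t x => ?_⟩
  have hper' : Function.Periodic (deriv G) (2 * π) := fun y => by
    rw [← deriv_comp_add_const]
    exact congrArg (fun f => deriv f y) (funext hper)
  have : x + 2 * π - l * t = x - l * t + 2 * π := by ring
  simp only [packet, this, hper _, hper' _]

theorem dx_packet (δ l e g : ℝ) {G : ℝ → ℂ} (hG : ContDiff ℝ ∞ G) (t x : ℝ) :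
    dx (packet δ l e g G) t x = packet δ l e g (deriv G) t x := by
  have hG' : ContDiff ℝ ∞ (deriv G) := (contDiff_infty_iff_deriv.1 hG).2
  have d1 : ∀ y, HasDerivAt G (deriv G y) y := fun y =>
    (hG.differentiable (by simp) y).hasDerivAt
  have d2 : ∀ y, HasDerivAt (deriv G) (deriv (deriv G) y) y := fun y =>
    (hG'.differentiable (by simp) y).hasDerivAt
  have h := (((d2 (x - l * t)).comp_sub_const x (l * t)).const_mul (e : ℂ)).add
    (((d1 (x - l * t)).comp_sub_const x (l * t)).const_mul (g : ℂ))
  exact (h.const_mul (Real.exp (δ * t) : ℂ)).deriv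

theorem dt_packet (δ l e g : ℝ) {G : ℝ → ℂ} (hG : ContDiff ℝ ∞ G) (t x : ℝ) :
    dt (packet δ l e g G) t x
      = δ * packet δ l e g G t x - l * packet δ l e g (deriv G) t x := by
  have hG' : ContDiff ℝ ∞ (deriv G) := (contDiff_infty_iff_deriv.1 hG).2
  have d1 : ∀ y, HasDerivAt G (deriv G y) y := fun y =>
    (hG.differentiable (by simp) y).hasDerivAt
  have d2 : ∀ y, HasDerivAt (deriv G) (deriv (deriv G) y) y := fun y =>
    (hG'.differentiable (by simp) y).hasDerivAt
  have hin : HasDerivAt (fun s : ℝ => x - l * s) (-l) t := by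
    simpa using ((hasDerivAt_id t).const_mul l).const_sub x
  have hexp : HasDerivAt (fun s : ℝ => (Real.exp (δ * s) : ℂ)) ((Real.exp (δ * t) * δ : ℝ) : ℂ) t := by
    have : HasDerivAt (fun s : ℝ => Real.exp (δ * s)) (Real.exp (δ * t) * δ) t := by
      simpa using ((hasDerivAt_id t).const_mul δ).exp
    exact this.ofReal_comp
  have h := hexp.mul ((((d2 (x - l * t)).scomp t hin).const_mul (e : ℂ)).add
    (((d1 (x - l * t)).scomp t hin).const_mul (g : ℂ)))
  refine h.deriv.trans ?_
  simp only [packet, Function.comp, Complex.real_smul, Pi.add_apply]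
  push_cast
  ring

/-- Amplitudes of an exact wave packet of speed `l` for the adjoint system: `(e₁, 1, e₃)` is an
eigenvector of its principal part, and `(g₁, 0, g₃)` corrects for the damping of the stress. -/
structure IsAmplitude (P : Params) (l δ e₁ e₃ g₁ g₃ : ℝ) : Prop where
  density_eigen : (P.us - l) * e₁ + P.b = 0
  velocity_eigen : P.ρs * e₁ + (P.us - l) - P.μ / P.κ * e₃ = 0
  stress_eigen : l * e₃ + 1 / P.ρs = 0
  density_corr : δ * e₁ + (P.us - l) * g₁ = 0
  velocity_corr : δ + P.ρs * g₁ - P.μ / P.κ * g₃ = 0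
  stress_corr : (δ - 1 / P.κ) * e₃ - l * g₃ = 0

/-- The roots give characteristics `x + r t = const` while packets are functions of `x - l t`, hence
`l = -r`. Solving the first and third eigenvector equations for `e₁` and `e₃` turns the second into
the cubic. The corrector system is singular, and `δ` is the value for which it is solvable. -/
theorem exists_isAmplitude (P : Params) {r : ℝ} (hr : P.speedCubic r = 0) :
    ∃ δ e₁ e₃ g₁ g₃, IsAmplitude P (-r) δ e₁ e₃ g₁ g₃ := by
  have hκ := P.κ_pos
  have hρ := P.ρs_pos
  have hμ := P.μ_pos
  have hu := P.us_pos
  have hb := P.b_pos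
  -- The denominators `r` and `us + r` do not vanish because the cubic is nonzero at `0` and at
  -- `-us`.
  have hr0 : r ≠ 0 := by
    rintro rfl
    have : P.μ * P.us / (P.κ * P.ρs) = 0 := by simpa [Params.speedCubic] using hr
    exact (by positivity : P.μ * P.us / (P.κ * P.ρs) ≠ 0) this
  have hur : P.us + r ≠ 0 := by
    intro h
    obtain rfl : r = -P.us := by linarith
    have h2 : P.speedCubic (-P.us) = P.b * P.ρs * P.us := by
      unfold Params.speedCubic; ring
    exact (by positivity : P.b * P.ρs * P.us ≠ 0) (h2.symm.trans hr)
  -- The coefficient of `δ` in `velocity_corr` once `g₁` and `g₃` are eliminated; it is a sum of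
  -- positive terms.
  set D : ℝ := P.ρs * P.b / (P.us + r) ^ 2 + P.μ / (P.κ * P.ρs) / r ^ 2 + 1 with hD
  have hD0 : D ≠ 0 := by
    have : 0 < D := by positivity
    exact this.ne'
  set δ : ℝ := P.μ / (P.κ * P.ρs) / (P.κ * r ^ 2) / D with hδ
  have hδD : δ * D = P.μ / (P.κ * P.ρs) / (P.κ * r ^ 2) := div_mul_cancel₀ _ hD0
  refine ⟨δ, -P.b / (P.us + r), 1 / (P.ρs * r), δ * P.b / (P.us + r) ^ 2,
    -(δ - 1 / P.κ) / (P.ρs * r ^ 2), ?_, ?_, ?_, ?_, ?_, ?_⟩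
  · rw [sub_neg_eq_add]; field_simp; ring
  · rw [sub_neg_eq_add]
    have h2 : P.ρs * (-P.b / (P.us + r)) + (P.us + r) - P.μ / P.κ * (1 / (P.ρs * r))
        = P.speedCubic r / (r * (P.us + r)) := by
      unfold Params.speedCubic
      field_simp
      ring
    rw [h2, hr, zero_div]
  · field_simp; ring
  · rw [sub_neg_eq_add]; field_simp; ring
  · rw [hD] at hδD
    have h3 : δ + P.ρs * (δ * P.b / (P.us + r) ^ 2)
        - P.μ / P.κ * (-(δ - 1 / P.κ) / (P.ρs * r ^ 2))
        = δ * (P.ρs * P.b / (P.us + r) ^ 2 + P.μ / (P.κ * P.ρs) / r ^ 2 + 1)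
          - P.μ / (P.κ * P.ρs) / (P.κ * r ^ 2) := by
      field_simp
      ring
    rw [h3, hδD, sub_self]
  · field_simp; ring

/-! ### Testing a solution against a wave packet -/

theorem integral_linear_four {α : Type*} [MeasurableSpace α] {ν : Measure α} {f g h i k : α → ℂ}
    (hf : Integrable f ν) (hg : Integrable g ν) (hh : Integrable h ν) (hi : Integrable i ν)
    (a b c d : ℂ) (hk : ∀ x, k x = a * f x + b * g x + c * h x + d * i x) :
    ∫ x, k x ∂ν = a * (∫ x, f x ∂ν) + b * (∫ x, g x ∂ν) + c * (∫ x, h x ∂ν) + d * ∫ x, i x ∂ν := by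
  have hf' := hf.const_mul a
  have hg' := hg.const_mul b
  have hh' := hh.const_mul c
  have h2 := integral_add hf' hg'
  have h3 := integral_add (hf'.add hg') hh'
  have h4 := integral_add ((hf'.add hg').add hh') (hi.const_mul d)
  simp only [Pi.add_apply, integral_const_mul] at h2 h3 h4
  rw [integral_congr_ae (Filter.Eventually.of_forall hk), h4, h3, h2]

theorem integral_linear_three {α : Type*} [MeasurableSpace α] {ν : Measure α} {f g h k : α → ℂ}
    (hf : Integrable f ν) (hg : Integrable g ν) (hh : Integrable h ν)
    (a b c : ℂ) (hk : ∀ x, k x = a * f x + b * g x + c * h x) :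
    ∫ x, k x ∂ν = a * (∫ x, f x ∂ν) + b * (∫ x, g x ∂ν) + c * ∫ x, h x ∂ν := by
  have := integral_linear_four (k := k) hf hg hh hh a b c 0 fun x => by rw [hk]; ring
  rw [this, zero_mul, add_zero]

/-- Tested against a wave packet that vanishes at the boundary, a solution does not see the
controls, and only the bounded function `G` enters the remainder. -/
theorem IsSolution.packet_identity {P : Params} {T : ℝ} {q r p : ℝ → ℂ} {z0 : State}
    {z : ℝ → State} (hz : IsSolution P T q r p z0 z) (hT : 0 ≤ T) {l δ e₁ e₃ g₁ g₃ : ℝ}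
    (ha : IsAmplitude P l δ e₁ e₃ g₁ g₃) {G : ℝ → ℂ} (hG : ContDiff ℝ ∞ G)
    (hper : Function.Periodic G (2 * π)) (hG0 : ∀ t ∈ Icc 0 T, G (-(l * t)) = 0)
    (hG1 : ∀ t ∈ Icc 0 T, deriv G (-(l * t)) = 0) :
    ((∫ x, (z T).1 x * packet δ l e₁ g₁ G T x ∂intervalMeasure)
        + (∫ x, (z T).2.1 x * packet δ l 1 0 G T x ∂intervalMeasure)
        + ∫ x, (z T).2.2 x * packet δ l e₃ g₃ G T x ∂intervalMeasure)
      - ((∫ x, z0.1 x * packet δ l e₁ g₁ G 0 x ∂intervalMeasure)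
        + (∫ x, z0.2.1 x * packet δ l 1 0 G 0 x ∂intervalMeasure)
        + ∫ x, z0.2.2 x * packet δ l e₃ g₃ G 0 x ∂intervalMeasure)
      = ∫ t in (0 : ℝ)..T, ((∫ x, (z t).1 x * packet δ l 0 (δ * g₁) G t x ∂intervalMeasure)
        + ∫ x, (z t).2.2 x * packet δ l 0 ((δ - 1 / P.κ) * g₃) G t x ∂intervalMeasure) := by
  have hG' : ContDiff ℝ ∞ (deriv G) := (contDiff_infty_iff_deriv.1 hG).2
  have hper' : Function.Periodic (deriv G) (2 * π) := fun y => by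
    rw [← deriv_comp_add_const]
    exact congrArg (fun f => deriv f y) (funext hper)
  -- The controls enter only multiplied by the test function at `x = 2π`, and periodicity moves that
  -- point to `-(l * t)`, where `G` and `G'` vanish.
  have hbd : ∀ e g : ℝ, ∀ t ∈ Icc 0 T, packet δ l e g G t (2 * π) = 0 := fun e g t ht => by
    have h : 2 * π - l * t = -(l * t) + 2 * π := by ring
    simp only [packet, h, hper _, hper' _, hG0 t ht, hG1 t ht, mul_zero, add_zero]
  have hbdint : ∀ (e g : ℝ) (c : ℝ → ℂ),
      ∫ t in (0 : ℝ)..T, c t * packet δ l e g G t (2 * π) = 0 := fun e g c => by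
    rw [intervalIntegral.integral_congr (g := fun _ => (0 : ℂ)), intervalIntegral.integral_zero]
    intro t ht
    rw [uIcc_of_le hT] at ht
    simp only [hbd e g t ht, mul_zero]
  have hcont : ∀ (e g : ℝ) {H : ℝ → ℂ}, ContDiff ℝ ∞ H →
      Continuous fun y : ℝ × ℝ => packet δ l e g H y.1 y.2 := fun e g H hH =>
    (contDiff_packet δ l e g hH).continuous
  have hcontx : ∀ (e g : ℝ) {H : ℝ → ℂ}, ContDiff ℝ ∞ H → ∀ t,
      Continuous (packet δ l e g H t) := fun e g H hH t =>
    (hcont e g hH).comp (by fun_prop : Continuous fun x => (t, x))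
  have hz1 : ContinuousOn (fun t => (z t).1) (Icc 0 T) := hz.continuousOn.fst
  have hz2 : ContinuousOn (fun t => (z t).2.1) (Icc 0 T) := hz.continuousOn.snd.fst
  have hz3 : ContinuousOn (fun t => (z t).2.2) (Icc 0 T) := hz.continuousOn.snd.snd
  have hI : ∀ {f : ℝ → L2}, ContinuousOn f (Icc 0 T) → ∀ (e g : ℝ) {H : ℝ → ℂ},
      ContDiff ℝ ∞ H → IntervalIntegrable
        (fun t => ∫ x, f t x * packet δ l e g H t x ∂intervalMeasure) volume 0 T :=
    fun hf e g H hH => (continuousOn_integral_mul hf (hcont e g hH)).intervalIntegrable_of_Icc hT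
  have hTm : T ∈ Icc 0 T := ⟨hT, le_rfl⟩
  have E1 := hz.density _ (isTest_packet δ l e₁ g₁ hG hper) T hTm
  have E2 := hz.velocity _ (isTest_packet δ l 1 0 hG hper) T hTm
  have E3 := hz.stress _ (isTest_packet δ l e₃ g₃ hG hper) T hTm
  rw [hbdint, add_zero] at E1 E2
  rw [hbdint, sub_zero] at E3
  simp only [dt_packet _ _ _ _ hG, dx_packet _ _ _ _ hG] at E1 E2 E3
  have hi : ∀ (f : L2) (e g : ℝ) {H : ℝ → ℂ}, ContDiff ℝ ∞ H → ∀ t,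
      Integrable (fun x => f x * packet δ l e g H t x) intervalMeasure := fun f e g H hH t =>
    integrable_mul_of_continuous f (hcontx e g hH t)
  have F1 : ∀ t, (∫ x, ((z t).1 x * (δ * packet δ l e₁ g₁ G t x
        - l * packet δ l e₁ g₁ (deriv G) t x)
      + (P.us * (z t).1 x + P.ρs * (z t).2.1 x) * packet δ l e₁ g₁ (deriv G) t x)
        ∂intervalMeasure)
      = δ * (∫ x, (z t).1 x * packet δ l e₁ g₁ G t x ∂intervalMeasure)
        + (P.us - l) * (∫ x, (z t).1 x * packet δ l e₁ g₁ (deriv G) t x ∂intervalMeasure)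
        + P.ρs * (∫ x, (z t).2.1 x * packet δ l e₁ g₁ (deriv G) t x ∂intervalMeasure) := by
    exact fun t => integral_linear_three (hi _ _ _ hG _) (hi _ _ _ hG' _) (hi _ _ _ hG' _) _ _ _
      fun x => by ring
  have F2 : ∀ t, (∫ x, ((z t).2.1 x * (δ * packet δ l 1 0 G t x
        - l * packet δ l 1 0 (deriv G) t x)
      + (P.us * (z t).2.1 x + P.b * (z t).1 x - 1 / P.ρs * (z t).2.2 x)
        * packet δ l 1 0 (deriv G) t x) ∂intervalMeasure)
      = δ * (∫ x, (z t).2.1 x * packet δ l 1 0 G t x ∂intervalMeasure)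
        + (P.us - l) * (∫ x, (z t).2.1 x * packet δ l 1 0 (deriv G) t x ∂intervalMeasure)
        + P.b * (∫ x, (z t).1 x * packet δ l 1 0 (deriv G) t x ∂intervalMeasure)
        + (-(1 / P.ρs)) * (∫ x, (z t).2.2 x * packet δ l 1 0 (deriv G) t x ∂intervalMeasure) := by
    exact fun t => integral_linear_four (hi _ _ _ hG _) (hi _ _ _ hG' _) (hi _ _ _ hG' _)
      (hi _ _ _ hG' _) _ _ _ _ fun x => by ring
  have F3 : ∀ t, (∫ x, ((z t).2.2 x * (δ * packet δ l e₃ g₃ G t x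
        - l * packet δ l e₃ g₃ (deriv G) t x)
      - 1 / P.κ * (z t).2.2 x * packet δ l e₃ g₃ G t x
      - P.μ / P.κ * (z t).2.1 x * packet δ l e₃ g₃ (deriv G) t x) ∂intervalMeasure)
      = (δ - 1 / P.κ) * (∫ x, (z t).2.2 x * packet δ l e₃ g₃ G t x ∂intervalMeasure)
        + (-l) * (∫ x, (z t).2.2 x * packet δ l e₃ g₃ (deriv G) t x ∂intervalMeasure)
        + (-(P.μ / P.κ)) * (∫ x, (z t).2.1 x * packet δ l e₃ g₃ (deriv G) t x
          ∂intervalMeasure) := by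
    exact fun t => integral_linear_three (hi _ _ _ hG _) (hi _ _ _ hG' _) (hi _ _ _ hG' _) _ _ _
      fun x => by ring
  simp only [F1] at E1
  simp only [F2] at E2
  simp only [F3] at E3
  have J1 := (((hI hz1 e₁ g₁ hG).const_mul (δ : ℂ)).add
    ((hI hz1 e₁ g₁ hG').const_mul (P.us - l : ℂ))).add
    ((hI hz2 e₁ g₁ hG').const_mul (P.ρs : ℂ))
  have J2 := ((((hI hz2 1 0 hG).const_mul (δ : ℂ)).add
    ((hI hz2 1 0 hG').const_mul (P.us - l : ℂ))).add
    ((hI hz1 1 0 hG').const_mul (P.b : ℂ))).add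
    ((hI hz3 1 0 hG').const_mul (-(1 / P.ρs) : ℂ))
  have J3 := (((hI hz3 e₃ g₃ hG).const_mul (δ - 1 / P.κ : ℂ)).add
    ((hI hz3 e₃ g₃ hG').const_mul (-l : ℂ))).add
    ((hI hz2 e₃ g₃ hG').const_mul (-(P.μ / P.κ) : ℂ))
  have key : ∀ a₁ a₂ a₃ b₁ b₂ b₃ : ℂ, (a₁ + a₂ + a₃) - (b₁ + b₂ + b₃)
      = (a₁ - b₁) + (a₂ - b₂) + (a₃ - b₃) := fun _ _ _ _ _ _ => by ring
  rw [key, E1, E2, E3, ← intervalIntegral.integral_add J1 J2,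
    ← intervalIntegral.integral_add (J1.add J2) J3]
  refine intervalIntegral.integral_congr fun t _ => ?_
  -- Together with `hd`, this reduces every integral to moments against `G''`, `G'` and `G`, so that
  -- coefficients can be compared order by order.
  have hs : ∀ (f : L2) (e g : ℝ) {H : ℝ → ℂ}, ContDiff ℝ ∞ H →
      ∫ x, f x * packet δ l e g H t x ∂intervalMeasure
        = e * (∫ x, f x * packet δ l 1 0 H t x ∂intervalMeasure)
          + g * ∫ x, f x * packet δ l 0 1 H t x ∂intervalMeasure := by
    intro f e g H hH
    simp only [← integral_const_mul]
    rw [← integral_add ((hi _ _ _ hH _).const_mul _) ((hi _ _ _ hH _).const_mul _)]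
    refine integral_congr_ae (Filter.Eventually.of_forall fun x => ?_)
    simp only [packet]
    push_cast
    ring
  have hd : ∀ f : L2, ∫ x, f x * packet δ l 0 1 (deriv G) t x ∂intervalMeasure
      = ∫ x, f x * packet δ l 1 0 G t x ∂intervalMeasure := fun f => by
    simp [packet]
  rw [hs (z t).1 e₁ g₁ hG, hs (z t).1 e₁ g₁ hG', hs (z t).2.1 e₁ g₁ hG', hs (z t).2.2 e₃ g₃ hG,
    hs (z t).2.2 e₃ g₃ hG', hs (z t).2.1 e₃ g₃ hG', hs (z t).1 0 (δ * g₁) hG,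
    hs (z t).2.2 0 ((δ - 1 / P.κ) * g₃) hG]
  simp only [hd]
  have R1 : ((P.us : ℂ) - l) * e₁ + P.b = 0 := by exact_mod_cast ha.density_eigen
  have R2 : (P.ρs : ℂ) * e₁ + (P.us - l) - P.μ / P.κ * e₃ = 0 := by
    exact_mod_cast ha.velocity_eigen
  have R3 : (l : ℂ) * e₃ + 1 / P.ρs = 0 := by exact_mod_cast ha.stress_eigen
  have Q1 : (δ : ℂ) * e₁ + (P.us - l) * g₁ = 0 := by exact_mod_cast ha.density_corr
  have Q2 : (δ : ℂ) + P.ρs * g₁ - P.μ / P.κ * g₃ = 0 := by exact_mod_cast ha.velocity_corr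
  have Q3 : ((δ : ℂ) - 1 / P.κ) * e₃ - l * g₃ = 0 := by exact_mod_cast ha.stress_corr
  push_cast
  -- The `G''` moments cancel by the eigenvector relations and the `G'` moments by the corrector
  -- relations. Only `G` moments of the density and the stress survive, since the velocity amplitude
  -- has no corrector.
  linear_combination
    (∫ x, (z t).1 x * packet δ l 1 0 (deriv G) t x ∂intervalMeasure) * R1
    + (∫ x, (z t).2.1 x * packet δ l 1 0 (deriv G) t x ∂intervalMeasure) * R2
    - (∫ x, (z t).2.2 x * packet δ l 1 0 (deriv G) t x ∂intervalMeasure) * R3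
    + (∫ x, (z t).1 x * packet δ l 1 0 G t x ∂intervalMeasure) * Q1
    + (∫ x, (z t).2.1 x * packet δ l 1 0 G t x ∂intervalMeasure) * Q2
    + (∫ x, (z t).2.2 x * packet δ l 1 0 G t x ∂intervalMeasure) * Q3

/-! ### Oscillating profiles that avoid the boundary -/

theorem integral_intervalMeasure {E : Type*} [NormedAddCommGroup E] [NormedSpace ℝ E]
    (f : ℝ → E) : ∫ x, f x ∂intervalMeasure = ∫ x in (0 : ℝ)..2 * π, f x := by
  rw [intervalIntegral.integral_of_le (by positivity), integral_Ioc_eq_integral_Ioo,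
    intervalMeasure]

/-- A periodic bump that a wave of speed `l` carries across `(0, 2π)` without touching the
boundary during the time interval `[0, T]`. -/
theorem exists_periodic_bump {l T : ℝ} (hT : 0 ≤ T) (hl : |l| * T < 2 * π) :
    ∃ χ : ℝ → ℝ, ContDiff ℝ ∞ χ ∧ Function.Periodic χ (2 * π) ∧ (∀ y, 0 ≤ χ y) ∧
      (∀ y, χ y ≤ 1) ∧ (∀ t ∈ Icc 0 T, χ (-(l * t)) = 0) ∧
      ∃ x ∈ Icc 0 (2 * π), 0 < χ (x - l * T) := by
  have hlT : |l * T / 2| < π := by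
    rw [abs_div, abs_mul, abs_of_nonneg hT, abs_two]
    linarith
  -- Shifted by `l * T / 2`, the points `-(l * t)` fill the symmetric interval of radius `|l| * T /
  -- 2 < π`, on which the cosine is at least its endpoint value `cos (l * T / 2)`. The argument of
  -- `expNegInvGlue` is thus nonpositive there, and it is positive at the antipode `y + l * T / 2 =
  -- π`.
  refine ⟨fun y => expNegInvGlue (Real.cos (l * T / 2) - Real.cos (y + l * T / 2)), ?_, ?_,
    fun _ => expNegInvGlue.nonneg _, fun y => ?_, fun t ht => ?_, π + l * T / 2, ?_, ?_⟩
  · exact expNegInvGlue.contDiff.comp (by fun_prop)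
  · intro y
    simp only
    rw [show y + 2 * π + l * T / 2 = y + l * T / 2 + 2 * π by ring, Real.cos_add_two_pi]
  · simp only [expNegInvGlue]
    split_ifs with h
    · exact zero_le_one
    · rw [not_le] at h
      exact Real.exp_le_one_iff.2 (neg_nonpos.2 (inv_nonneg.2 h.le))
  · refine expNegInvGlue.zero_of_nonpos (sub_nonpos.2 ?_)
    rw [← Real.cos_abs (l * T / 2), ← Real.cos_abs (-(l * t) + l * T / 2)]
    refine Real.cos_le_cos_of_nonneg_of_le_pi (abs_nonneg _) hlT.le ?_
    rw [show -(l * t) + l * T / 2 = l * (T / 2 - t) by ring,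
      show l * T / 2 = l * (T / 2) by ring, abs_mul, abs_mul]
    refine mul_le_mul_of_nonneg_left ?_ (abs_nonneg _)
    rw [abs_of_nonneg (by linarith : 0 ≤ T / 2), abs_le]
    constructor <;> linarith [ht.1, ht.2]
  · obtain ⟨h1, h2⟩ := abs_lt.1 hlT
    constructor <;> linarith
  · refine expNegInvGlue.pos_of_pos ?_
    rw [show π + l * T / 2 - l * T + l * T / 2 = π by ring, Real.cos_pi, ← Real.cos_abs]
    have := Real.cos_lt_cos_of_nonneg_of_le_pi (abs_nonneg _) le_rfl hlT
    rw [Real.cos_pi] at this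
    linarith

/-- The rapidly oscillating profile `χ(y) exp (i n y)`. -/
noncomputable def oscillation (χ : ℝ → ℝ) (n : ℕ) (y : ℝ) : ℂ :=
  (χ y : ℂ) * Complex.exp (((n : ℝ) * y : ℝ) * Complex.I)

theorem contDiff_oscillation {χ : ℝ → ℝ} (hχ : ContDiff ℝ ∞ χ) (n : ℕ) :
    ContDiff ℝ ∞ (oscillation χ n) := by
  have h1 : ContDiff ℝ ∞ fun y => (χ y : ℂ) := Complex.ofRealCLM.contDiff.comp hχ
  have h2 : ContDiff ℝ ∞ fun y : ℝ => (((n : ℝ) * y : ℝ) : ℂ) :=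
    Complex.ofRealCLM.contDiff.comp (by fun_prop : ContDiff ℝ ∞ fun y : ℝ => (n : ℝ) * y)
  exact h1.mul ((h2.mul contDiff_const).cexp)

theorem periodic_oscillation {χ : ℝ → ℝ} (hχ : Function.Periodic χ (2 * π)) (n : ℕ) :
    Function.Periodic (oscillation χ n) (2 * π) := fun y => by
  have h : (((n : ℝ) * (y + 2 * π) : ℝ) : ℂ) * Complex.I
      = (((n : ℝ) * y : ℝ) : ℂ) * Complex.I + n * (2 * π * Complex.I) := by
    push_cast
    ring
  rw [oscillation, oscillation, hχ, h, Complex.exp_add, Complex.exp_nat_mul_two_pi_mul_I, mul_one]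

theorem norm_oscillation {χ : ℝ → ℝ} (n : ℕ) (y : ℝ) : ‖oscillation χ n y‖ = |χ y| := by
  rw [oscillation, norm_mul, Complex.norm_exp_ofReal_mul_I, mul_one, Complex.norm_real,
    Real.norm_eq_abs]

theorem deriv_oscillation {χ : ℝ → ℝ} (hχ : ContDiff ℝ ∞ χ) (n : ℕ) (y : ℝ) :
    deriv (oscillation χ n) y
      = (deriv χ y + n * χ y * Complex.I) * Complex.exp (((n : ℝ) * y : ℝ) * Complex.I) := by
  have h1 : HasDerivAt (fun y => (χ y : ℂ)) ((deriv χ y : ℝ) : ℂ) y :=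
    (hχ.differentiable (by simp) y).hasDerivAt.ofReal_comp
  have h2 : HasDerivAt (fun y : ℝ => (((n : ℝ) * y : ℝ) : ℂ)) ((n : ℝ) : ℂ) y :=
    HasDerivAt.ofReal_comp (by simpa using (hasDerivAt_id y).const_mul (n : ℝ))
  refine (h1.mul ((h2.mul_const Complex.I).cexp)).deriv.trans ?_
  push_cast
  ring

/-! ### Bounded moments of reachable states and uniform boundedness -/

theorem integral_packet_one_zero (δ l : ℝ) {G : ℝ → ℂ} (hG : ContDiff ℝ ∞ G)
    (hper : Function.Periodic G (2 * π)) (t : ℝ) :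
    ∫ x, packet δ l 1 0 G t x ∂intervalMeasure = 0 := by
  have hG' : Continuous (deriv G) := (contDiff_infty_iff_deriv.1 hG).2.continuous
  have h : ∫ x in (0 : ℝ)..2 * π, deriv G (x - l * t) = 0 := by
    rw [intervalIntegral.integral_comp_sub_right (deriv G), intervalIntegral.integral_deriv_eq_sub
      (fun y _ => hG.differentiable (by simp) y) (hG'.intervalIntegrable _ _),
      show 2 * π - l * t = 0 - l * t + 2 * π by ring, hper, sub_self]
  rw [integral_intervalMeasure]
  simp [packet, h]

/-- The moment of the final velocity against an oscillating wave packet is bounded uniformly in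
the frequency. -/
theorem IsSolution.exists_bound_oscillation {P : Params} {T : ℝ} {q r p : ℝ → ℂ}
    {z : ℝ → State} (hz : IsSolution P T q r p 0 z) (hT : 0 ≤ T) {u : L2} (hu : z T = (0, u, 0))
    {l δ e₁ e₃ g₁ g₃ : ℝ} (ha : IsAmplitude P l δ e₁ e₃ g₁ g₃) {χ : ℝ → ℝ}
    (hχ : ContDiff ℝ ∞ χ) (hper : Function.Periodic χ (2 * π)) (hχ0 : ∀ y, 0 ≤ χ y)
    (hχ1 : ∀ y, χ y ≤ 1) (hχb : ∀ t ∈ Icc 0 T, χ (-(l * t)) = 0) :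
    ∃ C, ∀ n : ℕ,
      ‖∫ x, u x * packet δ l 1 0 (oscillation χ n) T x ∂intervalMeasure‖ ≤ C := by
  -- `M` depends on the trajectory but not on the frequency `n`.
  obtain ⟨M, hM⟩ := isCompact_Icc.exists_bound_of_continuousOn hz.continuousOn
  set K : ℝ → ℝ := fun g => Real.exp (|δ| * T) * |g| * (1 + 2 * π) * M with hK
  refine ⟨(K (δ * g₁) + K ((δ - 1 / P.κ) * g₃)) * |T - 0|, fun n => ?_⟩
  have hG := contDiff_oscillation hχ n
  -- A zero of the nonnegative function `χ` is a minimum, so the derivative vanishes there too.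
  have hχ' : ∀ t ∈ Icc 0 T, deriv χ (-(l * t)) = 0 := fun t ht =>
    IsLocalMin.deriv_eq_zero (Filter.Eventually.of_forall fun y => by
      rw [hχb t ht]; exact hχ0 y)
  have E := hz.packet_identity hT ha hG (periodic_oscillation hper n)
    (fun t ht => by simp [oscillation, hχb t ht])
    (fun t ht => by simp [deriv_oscillation hχ, hχb t ht, hχ' t ht])
  have hcont : ∀ (e g t : ℝ), Continuous (packet δ l e g (oscillation χ n) t) := fun e g t =>
    (contDiff_packet δ l e g hG).continuous.comp (by fun_prop : Continuous fun x => (t, x))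
  have h0 : ∀ e g t : ℝ,
      ∫ x, (0 : L2) x * packet δ l e g (oscillation χ n) t x ∂intervalMeasure = 0 :=
    fun e g t => map_zero (pairing _ (hcont e g t))
  simp only [hu, Prod.fst_zero, Prod.snd_zero, h0, zero_add, add_zero, sub_zero] at E
  rw [E]
  have hb : ∀ (f : L2) (g : ℝ), ‖f‖ ≤ M → ∀ t ∈ Icc 0 T,
      ‖∫ x, f x * packet δ l 0 g (oscillation χ n) t x ∂intervalMeasure‖ ≤ K g := by
    intro f g hf t ht
    refine (norm_integral_mul_le f (C := Real.exp (|δ| * T) * |g|) (by positivity)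
      fun x _ => ?_).trans (mul_le_mul_of_nonneg_left hf (by positivity))
    have h1 : δ * t ≤ |δ| * T := by
      have h2 := mul_le_mul_of_nonneg_right (le_abs_self δ) ht.1
      have h3 := mul_le_mul_of_nonneg_left ht.2 (abs_nonneg δ)
      linarith
    rw [packet, Complex.ofReal_zero, zero_mul, zero_add, norm_mul, norm_mul, norm_oscillation,
      Complex.norm_real, Complex.norm_real, Real.norm_eq_abs, Real.norm_eq_abs, Real.abs_exp,
      abs_of_nonneg (hχ0 _)]
    calc Real.exp (δ * t) * (|g| * χ (x - l * t)) ≤ Real.exp (|δ| * T) * (|g| * 1) := by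
          gcongr
          · exact mul_nonneg (abs_nonneg _) (hχ0 _)
          · exact hχ1 _
      _ = _ := by ring
  refine intervalIntegral.norm_integral_le_of_norm_le_const fun t ht => ?_
  rw [uIoc_of_le hT] at ht
  have ht' : t ∈ Icc 0 T := Ioc_subset_Icc_self ht
  have hzt := hM t ht'
  exact (norm_add_le _ _).trans (add_le_add
    (hb _ _ ((norm_fst_le _).trans hzt) t ht')
    (hb _ _ ((norm_snd_le _).trans ((norm_snd_le _).trans hzt)) t ht'))

/-- If a characteristic of speed `l` can stay inside the domain during `[0, T]`, then some velocity
of mean value zero cannot be reached from rest, whatever the boundary controls. -/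
theorem not_forall_reachable {P : Params} {T l δ e₁ e₃ g₁ g₃ : ℝ} (hT : 0 ≤ T)
    (hl : |l| * T < 2 * π) (ha : IsAmplitude P l δ e₁ e₃ g₁ g₃) :
    ¬ ∀ u : L2, (∫ x, u x ∂intervalMeasure) = 0 →
      ∃ (q r p : ℝ → ℂ) (z : ℝ → State), IsSolution P T q r p 0 z ∧ z T = (0, u, 0) := by
  intro hreach
  obtain ⟨χ, hχ, hper, hχ0, hχ1, hχb, x₀, hx₀, hχx₀⟩ := exists_periodic_bump hT hl
  have hcont : ∀ n : ℕ, Continuous (packet δ l 1 0 (oscillation χ n) T) := fun n =>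
    (contDiff_packet δ l 1 0 (contDiff_oscillation hχ n)).continuous.comp
      (by fun_prop : Continuous fun x => (T, x))
  have hbound : ∀ u : L2, ∃ C, ∀ n : ℕ, ‖pairing _ (hcont n) u‖ ≤ C := by
    intro u
    -- Reachability is assumed only for mean zero, but Banach–Steinhaus needs all of `L²`. Removing
    -- the mean costs nothing: the velocity packet is an `x`-derivative of a periodic function, so
    -- it annihilates constants.
    set m : ℂ := (∫ x, u x ∂intervalMeasure) / (2 * π) with hm
    set c : L2 := Lp.const 2 intervalMeasure m with hc
    have hcae : (c : ℝ → ℂ) =ᵐ[intervalMeasure] fun _ => m := Lp.coeFn_const _ _ _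
    have hπ : (2 * π : ℂ) ≠ 0 := by exact_mod_cast Real.two_pi_pos.ne'
    have hmean : ∫ x, (u - c : L2) x ∂intervalMeasure = 0 := by
      have h1 : Integrable u intervalMeasure := (Lp.memLp u).integrable (by norm_num)
      rw [integral_congr_ae (g := fun x => u x - m), integral_sub h1 (integrable_const _)]
      · rw [integral_intervalMeasure (fun _ => m), intervalIntegral.integral_const, sub_zero,
          Complex.real_smul, hm]
        push_cast
        field_simp
        ring
      · filter_upwards [Lp.coeFn_sub u c, hcae] with x h1 h2
        rw [h1, Pi.sub_apply, h2]
    obtain ⟨q, r, p, z, hz, hzT⟩ := hreach _ hmean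
    obtain ⟨C, hC⟩ := hz.exists_bound_oscillation hT hzT ha hχ hper hχ0 hχ1 hχb
    refine ⟨C, fun n => ?_⟩
    have hpc : pairing _ (hcont n) c = 0 := by
      rw [pairing_apply, integral_congr_ae
        (g := fun x => m * packet δ l 1 0 (oscillation χ n) T x), integral_const_mul,
        integral_packet_one_zero _ _ (contDiff_oscillation hχ n) (periodic_oscillation hper n),
        mul_zero]
      filter_upwards [hcae] with x hx
      rw [hx]
    have h := hC n
    rwa [← pairing_apply _ (hcont n), map_sub, hpc, sub_zero] at h
  obtain ⟨C, hC⟩ := banach_steinhaus hbound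
  have hχc : Continuous χ := hχ.continuous
  have hχ'c : Continuous (deriv χ) := (contDiff_infty_iff_deriv.1 hχ).2.continuous
  set A : ℝ := ∫ x, χ (x - l * T) * deriv χ (x - l * T) ∂intervalMeasure with hA
  set B : ℝ := ∫ x, χ (x - l * T) ^ 2 ∂intervalMeasure with hB
  have hBpos : 0 < B := by
    rw [hB, integral_intervalMeasure]
    exact intervalIntegral.integral_pos (by positivity) (by fun_prop)
      (fun x _ => sq_nonneg _) ⟨x₀, hx₀, pow_pos hχx₀ 2⟩
  -- Bounds the `L²` norm of any function of modulus at most `1`, hence of the test velocities `v`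
  -- below for every `n`.
  set K : ℝ := (measureUnivNNReal intervalMeasure : ℝ) ^ (2 : ENNReal).toReal⁻¹ * 1 with hK
  have hintR : ∀ {f : ℝ → ℝ}, Continuous f → Integrable (fun x => (f x : ℂ)) intervalMeasure :=
    fun {f} hf => by
      have h : IntegrableOn (fun x => (f x : ℂ)) (Ioo 0 (2 * π)) :=
        (Continuous.integrableOn_Icc (by fun_prop)).mono_set Ioo_subset_Icc_self
      exact h
  have hmain : ∀ n : ℕ, Real.exp (δ * T) * n * B ≤ C * K := by
    intro n
    -- The complex conjugate of the profile cancels the oscillation. The term of `G'` in which the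
    -- exponential is differentiated leaves `i n χ²`, so the imaginary part of the pairing is
    -- exactly `exp (δ T) * n * B`.
    set v : ℝ → ℂ := fun x =>
      χ (x - l * T) * Complex.exp (-(((n : ℝ) * (x - l * T) : ℝ) * Complex.I)) with hv
    have hvb : ∀ x, ‖v x‖ ≤ 1 := fun x => by
      rw [hv]
      simp only
      rw [norm_mul, ← neg_mul, ← Complex.ofReal_neg, Complex.norm_exp_ofReal_mul_I, mul_one,
        Complex.norm_real, Real.norm_eq_abs, abs_of_nonneg (hχ0 _)]
      exact hχ1 _
    have hvm : MemLp v 2 intervalMeasure :=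
      MemLp.of_bound (by rw [hv]; exact (by fun_prop : Continuous _).aestronglyMeasurable) 1
        (Filter.Eventually.of_forall hvb)
    have hvae := hvm.coeFn_toLp
    have hnorm : ‖hvm.toLp v‖ ≤ K := by
      refine Lp.norm_le_of_ae_bound zero_le_one ?_
      filter_upwards [hvae] with x hx
      rw [hx]
      exact hvb x
    have hval : pairing _ (hcont n) (hvm.toLp v)
        = Real.exp (δ * T) * A + Real.exp (δ * T) * n * Complex.I * B := by
      rw [pairing_apply, integral_congr_ae (g := fun x =>
        v x * packet δ l 1 0 (oscillation χ n) T x)]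
      · have f1 := hintR (f := fun x => χ (x - l * T) * deriv χ (x - l * T)) (by fun_prop)
        have f2 := hintR (f := fun x => χ (x - l * T) ^ 2) (by fun_prop)
        rw [integral_linear_three f1 f2 f2 (Real.exp (δ * T)) (Real.exp (δ * T) * n * Complex.I) 0,
          integral_complex_ofReal, integral_complex_ofReal, zero_mul, add_zero]
        intro x
        simp only [hv, packet, deriv_oscillation hχ, Complex.exp_neg]
        have := Complex.exp_ne_zero (((n : ℝ) * (x - l * T) : ℝ) * Complex.I)
        push_cast at this ⊢
        field_simp
        ring
      · filter_upwards [hvae] with x hx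
        rw [hx]
    have him : (pairing _ (hcont n) (hvm.toLp v)).im = Real.exp (δ * T) * n * B := by
      rw [hval, show (Real.exp (δ * T) * A + Real.exp (δ * T) * n * Complex.I * B : ℂ)
        = (Real.exp (δ * T) * A : ℝ) + (Real.exp (δ * T) * n * B : ℝ) * Complex.I by
          push_cast; ring, Complex.add_im, Complex.ofReal_im, zero_add, Complex.im_ofReal_mul,
        Complex.I_im, mul_one]
    have hC0 : 0 ≤ C := (norm_nonneg _).trans (hC 0)
    calc Real.exp (δ * T) * n * B ≤ ‖pairing _ (hcont n) (hvm.toLp v)‖ := by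
          rw [← him]
          exact (le_abs_self _).trans (Complex.abs_im_le_norm _)
      _ ≤ C * ‖hvm.toLp v‖ := ContinuousLinearMap.le_of_opNorm_le _ (hC n) _
      _ ≤ C * K := mul_le_mul_of_nonneg_left hnorm hC0
  obtain ⟨n, hn⟩ := exists_nat_gt (C * K / (Real.exp (δ * T) * B))
  rw [div_lt_iff₀ (by positivity)] at hn
  linarith [hmain n]

/-! ### Conclusion with the slowest characteristic -/

theorem integral_zero_L2 : ∫ x, (0 : L2) x ∂intervalMeasure = 0 := by
  rw [integral_congr_ae (Lp.coeFn_zero ℂ 2 intervalMeasure)]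
  simp

theorem IsExactlyControllable.mono {P : Params} {j : Component} {V W : Set State} {T : ℝ}
    (h : IsExactlyControllable P j W T) (hVW : V ⊆ W) : IsExactlyControllable P j V T :=
  fun z0 h0 z1 h1 => h z0 (hVW h0) z1 (hVW h1)

/-- Apply `not_forall_reachable` to a root of least modulus, for which `|l| * T = β * T < 2π`. The
initial state `0` and the targets `(0, u, 0)` all lie in `meanZero`, and the full space follows
because controllability passes to smaller sets of states. -/
theorem not_isExactlyControllable_meanZero (P : Params) (j : Component) {T : ℝ} (hT : 0 < T)
    (hTβ : T < 2 * π / P.β) : ¬ IsExactlyControllable P j meanZero T := by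
  intro h
  obtain ⟨β₁, β₂, β₃, h12, h2, h3, hroots⟩ := P.exists_roots
  have hβ := P.β_eq_min hroots
  obtain ⟨r, hr, hrβ⟩ : ∃ r, P.speedCubic r = 0 ∧ |r| = P.β := by
    rw [hβ]
    rcases min_choice |β₁| (min |β₂| |β₃|) with h' | h' <;> rw [h']
    · exact ⟨β₁, by simp [hroots], rfl⟩
    · rcases min_choice |β₂| |β₃| with h'' | h'' <;> rw [h'']
      · exact ⟨β₂, by simp [hroots], rfl⟩
      · exact ⟨β₃, by simp [hroots], rfl⟩
  have hβpos : 0 < P.β := by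
    rw [hβ]
    exact lt_min (abs_pos.2 (h12.trans h2).ne) (lt_min (abs_pos.2 h2.ne) (abs_pos.2 h3.ne'))
  obtain ⟨δ, e₁, e₃, g₁, g₃, ha⟩ := exists_isAmplitude P hr
  refine not_forall_reachable hT.le ?_ ha fun u hu => ?_
  · rw [abs_neg, hrβ, mul_comm]
    exact (lt_div_iff₀ hβpos).1 hTβ
  have h0 := integral_zero_L2
  obtain ⟨c, -, z, hz, hzT⟩ := h 0 ⟨h0, h0, h0⟩ (0, u, 0) ⟨h0, hu, h0⟩
  cases j with
  | density => exact ⟨c, 0, 0, z, hz, hzT⟩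
  | velocity => exact ⟨0, c, 0, z, hz, hzT⟩
  | stress => exact ⟨0, 0, c, z, hz, hzT⟩

end MaxwellNS

theorem mainTheorem6 (P : MaxwellNS.Params) (T : ℝ) (hT : 0 < T) (hTβ : T < 2 * Real.pi / P.β) :
    (¬ MaxwellNS.IsExactlyControllable P .velocity Set.univ T ∧
      ¬ MaxwellNS.IsExactlyControllable P .velocity MaxwellNS.meanZero T) ∧
    (¬ MaxwellNS.IsExactlyControllable P .density Set.univ T ∧
      ¬ MaxwellNS.IsExactlyControllable P .density MaxwellNS.meanZero T) ∧
    (¬ MaxwellNS.IsExactlyControllable P .stress Set.univ T ∧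
      ¬ MaxwellNS.IsExactlyControllable P .stress MaxwellNS.meanZero T) := by
  have key : ∀ j, ¬ MaxwellNS.IsExactlyControllable P j Set.univ T ∧
      ¬ MaxwellNS.IsExactlyControllable P j MaxwellNS.meanZero T := fun j =>
    have h := MaxwellNS.not_isExactlyControllable_meanZero P j hT hTβ
    ⟨fun h' => h (h'.mono (Set.subset_univ _)), h⟩
  exact ⟨key _, key _, key _⟩
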